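/- Let $1\le k\le n$ and $\lambda>0$. A source multicasts time-stamped updates $j=1,2,\dots$ to nodes $1,\dots,n$; nodes $1,\dots,k$ are the priority nodes, the others are the non-priority nodes. The time $X_{ij}$ needed to deliver update $j$ to node $i$ is exponentially distributed with rate $\lambda$, and the $X_{ij}$ are independent over all $i,j$. Update $1$ is generated at time $T_0=0$. Update $j$ is generated at time $T_{j-1}$, which is its timestamp, and is completed when it has reached all priority nodes, at time $T_j=T_{j-1}+Y_j$ with $Y_j=\max_{1\le i\le k}X_{ij}$; at that instant its remaining transmissions are terminated and update $j+1$ is generated. Thus node $i$ receives update $j$ if and only if $X_{ij}\le Y_j$, and then at time $T_{j-1}+X_{ij}$. Let $u_i(t)$ be the timestamp of the most recent update received by node $i$ up to time $t$ (before its first reception, an arbitrary initial timestamp $u_i(0)\le 0$), and let $\Delta_i(t)=t-u_i(t)$ be the age at node $i$. Then for every node $i$, priority or non-priority, the time-averaged age exists almost surely and has the same value $$\lim_{\tau\to\infty}\frac1\tau\int_0^\tau\Delta_i(t)\,dt=\frac1\lambda+\frac{H_k}{2\lambda}+\frac{H_{k^{(2)}}}{2\lambda H_k},$$ where $H_k=\sum_{j=1}^k\frac1j$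 and $H_{k^{(2)}}=\sum_{j=1}^k\frac1{j^2}$. -/

import Mathlib

namespace MulticastAge

/-- Generalized harmonic number of order `s`: the sum of `1 / j ^ s` over `1 ≤ j ≤ k`. -/
noncomputable def genHarmonic (s k : ℕ) : ℝ :=
  ∑ j ∈ Finset.Icc 1 k, 1 / (j : ℝ) ^ s

variable {Ω : Type*} {n : ℕ}

/-- Length of the service interval of update `j`: the largest of the link delays `X i j` over the
priority nodes. The nodes are indexed by `Fin n`, the priority nodes are those with `i < k`,
and the updates are numbered from `0`. -/
noncomputable def serviceInterval (k : ℕ) (X : Fin n → ℕ → Ω → ℝ) (j : ℕ) (ω : Ω) : ℝ :=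
  ⨆ i : {i : Fin n // (i : ℕ) < k}, X i.1 j ω

/-- Time at which update `j` is generated (its timestamp): update `0` is generated at time `0`, and
each further update when its predecessor has reached all the priority nodes. -/
noncomputable def timestamp (k : ℕ) (X : Fin n → ℕ → Ω → ℝ) (j : ℕ) (ω : Ω) : ℝ :=
  ∑ l ∈ Finset.range j, serviceInterval k X l ω

/-- Update `j` is delivered to node `i`, that is, its transmission to `i` takes no longer than the
service interval, at the end of which all transmissions of the update are terminated. -/
def Delivered (k : ℕ) (X : Fin n → ℕ → Ω → ℝ) (i : Fin n) (j : ℕ) (ω : Ω) : Prop :=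
  X i j ω ≤ serviceInterval k X j ω

/-- Timestamp of the most recent update received by node `i` up to time `t`. Before the first
delivery this is the timestamp `u₀ i` of the update that the node holds at time `0`. -/
noncomputable def lastTimestamp (k : ℕ) (X : Fin n → ℕ → Ω → ℝ) (u₀ : Fin n → Ω → ℝ)
    (i : Fin n) (t : ℝ) (ω : Ω) : ℝ :=
  sSup (insert (u₀ i ω)
    {s : ℝ | ∃ j : ℕ, Delivered k X i j ω ∧ timestamp k X j ω + X i j ω ≤ t ∧
      s = timestamp k X j ω})

/-- The age at node `i` at time `t`. -/
noncomputable def age (k : ℕ) (X : Fin n → ℕ → Ω → ℝ) (u₀ : Fin n → Ω → ℝ)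
    (i : Fin n) (t : ℝ) (ω : Ω) : ℝ :=
  t - lastTimestamp k X u₀ i t ω

/-- The function `f` on `[0, ∞)` is locally integrable and has time average `a`. -/
def HasTimeAverage (f : ℝ → ℝ) (a : ℝ) : Prop :=
  (∀ τ : ℝ, 0 ≤ τ → IntervalIntegrable f MeasureTheory.volume 0 τ) ∧
    Filter.Tendsto (fun τ : ℝ => (1 / τ) * ∫ t in (0 : ℝ)..τ, f t) Filter.atTop (nhds a)

end MulticastAge

/-! Fix a node `i`. Let `B_j` be the age, at the start of cycle `j`, of the update that it holds,
and `q` the probability that a cycle misses it. During cycle `j` the age is the time elapsed in the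
cycle, plus `B_j` until the delivery or the end of the cycle. Its integral is therefore `Y_j² / 2 +
M_j B_j` with `M_j = min X_ij Y_j` (`integral_age_cycle`), and `B_{j+1} = Y_j + 1_{missed} B_j`.

The delays of cycle `j` are independent of `B_j`, so `M_j B_j` averages to `E M · E Y / (1 - q)`.
Moreover `E M = (1 - q) / λ` for every node (`integral_min_eval_prioMax`): a priority node has `q =
0` and `M = X`; otherwise `X` is independent of `Y`, and `E[min X y] = P(X ≤ y) / λ` for each fixed
`y`. The factor `1 - q`, the only trace of the node, cancels. Dividing by the mean cycle length
gives `1 / λ + E Y² / (2 E Y)`, where `E Y = H / λ` and `E Y² = (H² + H⁽²⁾) / λ²` are moments of a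
maximum of `k` exponential variables.

The products `M_j B_j` are dependent, so the usual strong law does not apply to them. Centering the
factor that depends on cycle `j` leaves martingale differences with bounded second moments, whose
averages vanish almost surely; the averages of `B_j` itself follow by summing the recursion
(`ae_tendsto_average_mul_affineRec`). -/

open MeasureTheory ProbabilityTheory Filter Topology

namespace MulticastAge

/-! ### Strong law for martingale differences -/

/-- **Kronecker's lemma** for the weights `1 / (j + 1)`. -/
theorem tendsto_sum_div_zero_of_tendsto_sum_div {d : ℕ → ℝ} {c : ℝ}
    (h : Tendsto (fun N => ∑ j ∈ Finset.range N, d j / ((j : ℝ) + 1)) atTop (𝓝 c)) :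
    Tendsto (fun N : ℕ => (∑ j ∈ Finset.range N, d j) / N) atTop (𝓝 0) := by
  set W : ℕ → ℝ := fun N => ∑ j ∈ Finset.range N, d j / ((j : ℝ) + 1) with hW
  -- Summation by parts: the average of the `d j` is `W N` minus the Cesàro mean of `W`, and both
  -- have the limit `c`.
  have key : ∀ N : ℕ, ∑ j ∈ Finset.range N, d j = N * W N - ∑ j ∈ Finset.range N, W j := by
    intro N
    induction N with
    | zero => simp
    | succ N ih =>
      have h1 : W (N + 1) = W N + d N / ((N : ℝ) + 1) := by simp [hW, Finset.sum_range_succ]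
      have h2 : ((N : ℝ) + 1) ≠ 0 := by positivity
      rw [Finset.sum_range_succ, Finset.sum_range_succ, ih, h1]
      push_cast
      field_simp
      ring
  have h2 := h.sub h.cesaro
  rw [sub_self] at h2
  refine h2.congr' ?_
  filter_upwards [eventually_gt_atTop 0] with N hN
  have : (N : ℝ) ≠ 0 := by positivity
  rw [key]
  change W N - (N : ℝ)⁻¹ * _ = _
  field_simp

variable {Ω : Type*} [mΩ : MeasurableSpace Ω] {P : Measure Ω}

/-- Strong law of large numbers for martingale differences with bounded second moments. -/
theorem ae_tendsto_average_of_martingale_difference [IsProbabilityMeasure P]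
    {ℱ : Filtration ℕ mΩ} {d : ℕ → Ω → ℝ} (hadp : StronglyAdapted ℱ d)
    (hL2 : ∀ j, MemLp (d j) 2 P) (hce : ∀ j, P[d (j + 1) | ℱ j] =ᵐ[P] 0) {C : ℝ}
    (hC : ∀ j, ∫ ω, d j ω ^ 2 ∂P ≤ C) :
    ∀ᵐ ω ∂P, Tendsto (fun N : ℕ => (∑ j ∈ Finset.range N, d j ω) / N) atTop (𝓝 0) := by
  set V : ℕ → Ω → ℝ := fun N ω => ∑ j ∈ Finset.range (N + 1), d j ω / ((j : ℝ) + 1) with hV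
  have hVsucc : ∀ N, V (N + 1) = fun ω => V N ω + d (N + 1) ω * ((N : ℝ) + 2)⁻¹ := by
    intro N
    ext ω
    simp only [hV]
    rw [Finset.sum_range_succ]
    push_cast
    rw [div_eq_mul_inv]
    ring_nf
  have hC0 : 0 ≤ C := (integral_nonneg fun ω => sq_nonneg _).trans (hC 0)
  have hVL2 : ∀ N, MemLp (V N) 2 P := by
    intro N
    simp only [hV, div_eq_mul_inv]
    exact memLp_finsetSum _ fun j _ => (hL2 j).mul_const _
  have hVadp : StronglyAdapted ℱ V := by
    intro N
    simp only [hV, div_eq_mul_inv]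
    refine Finset.stronglyMeasurable_fun_sum _ fun j hj => ?_
    exact ((hadp j).mono (ℱ.mono (by simp at hj; omega))).mul_const _
  have hmart : Martingale V ℱ P := by
    refine martingale_of_condExp_sub_eq_zero_nat hVadp
      (fun N => (hVL2 N).integrable (by norm_num)) fun N => ?_
    have : V (N + 1) - V N = ((N : ℝ) + 2)⁻¹ • d (N + 1) := by
      rw [hVsucc]
      ext ω
      simp [mul_comm]
    rw [this]
    filter_upwards [condExp_smul (((N : ℝ) + 2)⁻¹) (d (N + 1)) (ℱ N) (μ := P), hce N] with ω h1 h2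
    rw [h1]
    simp [h2]
  -- The increments are orthogonal, so the second moment is at most `C` times the sum of `1 / (j +
  -- 1) ^ 2`; the bound is in telescoping form so that the induction closes.
  have hsq : ∀ N, ∫ ω, V N ω ^ 2 ∂P ≤ C * (2 - 1 / ((N : ℝ) + 1)) := by
    intro N
    induction N with
    | zero =>
      simp only [hV]
      simpa [show (2 : ℝ) - 1 = 1 by norm_num] using hC 0
    | succ N ih =>
      have hint : Integrable (V N * d (N + 1)) P := (hVL2 N).integrable_mul (hL2 (N + 1))
      have hcross : ∫ ω, (V N * d (N + 1)) ω ∂P = 0 := by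
        rw [← integral_condExp (ℱ.le N)]
        have := condExp_mul_of_stronglyMeasurable_left (hVadp N) hint
          ((hL2 (N + 1)).integrable (by norm_num))
        rw [integral_congr_ae this]
        refine integral_eq_zero_of_ae ?_
        filter_upwards [hce N] with ω h2
        simp [h2]
      have hexp : ∀ ω, V (N + 1) ω ^ 2 = V N ω ^ 2 + (2 * ((N : ℝ) + 2)⁻¹) * (V N * d (N + 1)) ω
          + (((N : ℝ) + 2)⁻¹) ^ 2 * d (N + 1) ω ^ 2 := by
        intro ω
        rw [hVsucc]
        simp only [Pi.mul_apply]
        ring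
      simp_rw [hexp]
      have hint2 : Integrable (fun ω => V N ω ^ 2 + (2 * ((N : ℝ) + 2)⁻¹) *
          (V N * d (N + 1)) ω) P := (hVL2 N).integrable_sq.add (hint.const_mul _)
      rw [integral_add hint2 ((hL2 (N + 1)).integrable_sq.const_mul _),
        integral_add (hVL2 N).integrable_sq (hint.const_mul _), integral_const_mul,
        integral_const_mul, hcross]
      have h1 := mul_le_mul_of_nonneg_left (hC (N + 1)) (sq_nonneg ((N : ℝ) + 2)⁻¹)
      have h2 : (2 - 1 / ((N : ℝ) + 1)) + (((N : ℝ) + 2)⁻¹) ^ 2 ≤ 2 - 1 / (((N + 1 : ℕ) : ℝ) + 1) := by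
        have h3 : (0 : ℝ) < (N : ℝ) + 1 := by positivity
        have h4 : (0 : ℝ) < (N : ℝ) + 2 := by positivity
        have h5 : 1 / ((N : ℝ) + 1) - 1 / ((N : ℝ) + 2) - (((N : ℝ) + 2)⁻¹) ^ 2
            = 1 / (((N : ℝ) + 1) * ((N : ℝ) + 2) ^ 2) := by
          field_simp
          ring
        have h6 : 0 ≤ 1 / (((N : ℝ) + 1) * ((N : ℝ) + 2) ^ 2) := by positivity
        push_cast
        rw [show (N : ℝ) + 1 + 1 = N + 2 by ring]
        linarith
      have h7 := mul_le_mul_of_nonneg_left h2 hC0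
      nlinarith
  -- Martingale convergence asks for an `L¹` bound, obtained from the `L²` bound by `|v| ≤ 1 + v ^
  -- 2`.
  have hbdd : ∀ N, eLpNorm (V N) 1 P ≤ (1 + 2 * C).toNNReal := by
    intro N
    rw [eLpNorm_one_eq_lintegral_enorm, ← ofReal_integral_norm_eq_lintegral_enorm
      ((hVL2 N).integrable (by norm_num))]
    refine ENNReal.ofReal_le_ofReal ?_
    calc ∫ ω, ‖V N ω‖ ∂P ≤ ∫ ω, (1 + V N ω ^ 2) ∂P := by
          refine integral_mono ((hVL2 N).integrable (by norm_num)).norm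
            ((integrable_const _).add (hVL2 N).integrable_sq) fun ω => ?_
          simp only [Real.norm_eq_abs]
          nlinarith [sq_abs (V N ω), sq_nonneg (|V N ω| - 1)]
      _ = 1 + ∫ ω, V N ω ^ 2 ∂P := by
          rw [integral_add (integrable_const _) (hVL2 N).integrable_sq]
          simp
      _ ≤ 1 + 2 * C := by
          have : 0 ≤ 1 / ((N : ℝ) + 1) := by positivity
          nlinarith [hsq N]
  filter_upwards [hmart.submartingale.exists_ae_tendsto_of_bdd hbdd] with ω ⟨c, hc⟩
  exact tendsto_sum_div_zero_of_tendsto_sum_div ((tendsto_add_atTop_iff_nat 1).1 hc)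

/-! ### Affine recursions with i.i.d. random coefficients -/

/-- The solution of the affine recursion `b (j + 1) = a j + c j * b j` with `b 0 = b₀`. -/
def affineRec (a c : ℕ → ℝ) (b₀ : ℝ) : ℕ → ℝ
  | 0 => b₀
  | j + 1 => a j + c j * affineRec a c b₀ j

/-- The expectations of `(B N / N) ^ 2` are summable, so their sum is almost surely finite and its
terms tend to zero; no independence is needed. -/
theorem ae_tendsto_div_of_integral_sq_le [IsProbabilityMeasure P] {B : ℕ → Ω → ℝ}
    (hL2 : ∀ j, MemLp (B j) 2 P) {C : ℝ} (hC : ∀ j, ∫ ω, B j ω ^ 2 ∂P ≤ C) :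
    ∀ᵐ ω ∂P, Tendsto (fun N : ℕ => B N ω / N) atTop (𝓝 0) := by
  have hint : ∀ N, Integrable (fun ω => (B N ω / N) ^ 2) P := fun N => by
    simp only [div_pow]
    exact (hL2 N).integrable_sq.div_const _
  have hsum : Summable fun N : ℕ => ∫ ω, (B N ω / N) ^ 2 ∂P := by
    refine Summable.of_nonneg_of_le (fun N => integral_nonneg fun ω => sq_nonneg _)
      (fun N => ?_) ((Real.summable_one_div_nat_pow.2 (by norm_num : 1 < 2)).mul_left C)
    simp only [div_pow]
    rw [integral_div, mul_one_div]
    exact div_le_div_of_nonneg_right (hC N) (by positivity)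
  have hfin : ∫⁻ ω, ∑' N : ℕ, ENNReal.ofReal ((B N ω / N) ^ 2) ∂P ≠ ⊤ := by
    rw [lintegral_tsum fun N => (hint N).1.aemeasurable.ennreal_ofReal]
    simp_rw [fun N => (ofReal_integral_eq_lintegral_ofReal (hint N)
      (ae_of_all _ fun ω => sq_nonneg _)).symm]
    exact hsum.tsum_ofReal_ne_top
  have hmeas : AEMeasurable (fun ω => ∑' N : ℕ, ENNReal.ofReal ((B N ω / N) ^ 2)) P :=
    AEMeasurable.tsum fun N => (hint N).1.aemeasurable.ennreal_ofReal
  filter_upwards [ae_lt_top' hmeas hfin] with ω hω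
  have h1 := ENNReal.tendsto_atTop_zero_of_tsum_ne_top hω.ne
  have h2 := (ENNReal.tendsto_toReal ENNReal.zero_ne_top).comp h1
  have h3 : Tendsto (fun N : ℕ => (B N ω / N) ^ 2) atTop (𝓝 0) := by
    refine h2.congr fun N => ?_
    simp [ENNReal.toReal_ofReal (sq_nonneg _)]
  have h4 := h3.sqrt
  simp only [Real.sqrt_sq_eq_abs, Real.sqrt_zero] at h4
  exact (tendsto_zero_iff_abs_tendsto_zero _).2 h4

theorem memLp_mul_of_indepFun {X Y : Ω → ℝ} (hX : MemLp X 2 P) (hY : MemLp Y 2 P)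
    (hXY : IndepFun X Y P) :
    MemLp (fun ω => X ω * Y ω) 2 P ∧
      ∫ ω, (X ω * Y ω) ^ 2 ∂P = (∫ ω, X ω ^ 2 ∂P) * ∫ ω, Y ω ^ 2 ∂P := by
  have h := hXY.comp (φ := fun x : ℝ => x ^ 2) (ψ := fun x : ℝ => x ^ 2)
    (measurable_id.pow_const 2) (measurable_id.pow_const 2)
  constructor
  · refine (memLp_two_iff_integrable_sq (hX.1.mul hY.1)).2 ?_
    simp only [Pi.mul_apply, mul_pow]
    exact h.integrable_mul hX.integrable_sq hY.integrable_sq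
  · simp only [mul_pow]
    exact h.integral_fun_mul_eq_mul_integral hX.integrable_sq.1 hY.integrable_sq.1

section IID

variable {E : Type*} [MeasurableSpace E] {ξ : ℕ → Ω → E} {ν : Measure E}

theorem ae_tendsto_average_comp (hξ : ∀ j, Measurable (ξ j)) (hlaw : ∀ j, HasLaw (ξ j) ν P)
    (hindep : iIndepFun ξ P) {f : E → ℝ} (hf : Measurable f) (hfint : Integrable f ν) :
    ∀ᵐ ω ∂P, Tendsto (fun N : ℕ => (∑ j ∈ Finset.range N, f (ξ j ω)) / N) atTop
      (𝓝 (∫ x, f x ∂ν)) := by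
  have h := strong_law_ae_real (μ := P) (fun j ω => f (ξ j ω))
    ((hlaw 0).map_eq ▸ hfint |>.comp_measurable (hξ 0))
    (fun i j hij => (hindep.indepFun hij).comp hf hf)
    (fun j => ((⟨(hξ j).aemeasurable, (hξ 0).aemeasurable,
      (hlaw j).map_eq.trans (hlaw 0).map_eq.symm⟩ : IdentDistrib (ξ j) (ξ 0) P P)).comp hf)
  rwa [← (hlaw 0).integral_comp hf.aestronglyMeasurable]

theorem memLp_comp_of_hasLaw {f : E → ℝ} {X : Ω → E} (hX : HasLaw X ν P)
    (hf : MemLp f 2 ν) :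
    MemLp (fun ω => f (X ω)) 2 P :=
  (memLp_map_measure_iff (hX.map_eq ▸ hf.1) hX.aemeasurable).1 (hX.map_eq ▸ hf)

variable [NormedAddCommGroup E] [BorelSpace E]

variable {f g h : E → ℝ}

/-- The term of index `j + 1` uses only the inputs up to `j`. This shift makes the recursion
predictable: its term `j` is independent of the input `j`. -/
theorem stronglyMeasurable_affineRec (hξ : ∀ j, StronglyMeasurable (ξ j)) (hf : Measurable f)
    (hh : Measurable h) (j : ℕ) :
    StronglyMeasurable[Filtration.natural ξ hξ j]
      (fun ω => affineRec (fun l => f (ξ l ω)) (fun l => h (ξ l ω)) 0 (j + 1)) := by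
  have key : ∀ j, StronglyMeasurable[Filtration.natural ξ hξ j] (ξ j) :=
    Filtration.stronglyAdapted_natural hξ
  induction j with
  | zero =>
    simp only [affineRec, mul_zero, add_zero]
    exact (hf.comp (key 0).measurable).stronglyMeasurable
  | succ j ih =>
    rw [show (fun ω => affineRec (fun l => f (ξ l ω)) (fun l => h (ξ l ω)) 0 (j + 1 + 1)) =
      fun ω => f (ξ (j + 1) ω) + h (ξ (j + 1) ω) *
        affineRec (fun l => f (ξ l ω)) (fun l => h (ξ l ω)) 0 (j + 1) from rfl]
    exact (hf.comp (key (j + 1)).measurable).stronglyMeasurable.add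
      ((hh.comp (key (j + 1)).measurable).stronglyMeasurable.mul
        (ih.mono ((Filtration.natural ξ hξ).mono j.le_succ)))

variable [SecondCountableTopology E]

theorem indepFun_affineRec (hξ : ∀ j, Measurable (ξ j)) (hindep : iIndepFun ξ P)
    (hf : Measurable f) (hh : Measurable h) (j : ℕ) :
    IndepFun (ξ j) (fun ω => affineRec (fun l => f (ξ l ω)) (fun l => h (ξ l ω)) 0 j) P := by
  have := hindep.isProbabilityMeasure
  cases j with
  | zero => exact indepFun_const_right (ξ 0) (0 : ℝ)
  | succ j =>
    have hξ' := fun j => (hξ j).stronglyMeasurable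
    exact indep_of_indep_of_le_right (hindep.indep_comap_natural_of_lt hξ' j.lt_succ_self)
      (stronglyMeasurable_affineRec hξ' hf hh j).measurable.comap_le

/-- By independence, multiplication by `h (ξ j)` scales the second moment by `s < 1`. Young's
inequality, with a weight so small that the factor stays below one, absorbs the cross term with `f`.
-/
theorem memLp_affineRec_and_exists_bound (hξ : ∀ j, Measurable (ξ j))
    (hlaw : ∀ j, HasLaw (ξ j) ν P) (hindep : iIndepFun ξ P)
    (hf : Measurable f) (hh : Measurable h) (hfL2 : MemLp f 2 ν) (hhL2 : MemLp h 2 ν)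
    (hh2 : ∫ x, h x ^ 2 ∂ν < 1) :
    (∀ j, MemLp (fun ω => affineRec (fun l => f (ξ l ω)) (fun l => h (ξ l ω)) 0 j) 2 P) ∧
    ∃ C, ∀ j, ∫ ω, affineRec (fun l => f (ξ l ω)) (fun l => h (ξ l ω)) 0 j ^ 2 ∂P ≤ C := by
  set B : ℕ → Ω → ℝ := fun j ω => affineRec (fun l => f (ξ l ω)) (fun l => h (ξ l ω)) 0 j with hB
  have hsucc : ∀ j, B (j + 1) = fun ω => f (ξ j ω) + h (ξ j ω) * B j ω := fun j => rfl
  have hind : ∀ j, IndepFun (fun ω => h (ξ j ω)) (B j) P := fun j =>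
    (indepFun_affineRec hξ hindep hf hh j).comp hh measurable_id
  have hfP := fun j => memLp_comp_of_hasLaw (hlaw j) hfL2
  have hhP := fun j => memLp_comp_of_hasLaw (hlaw j) hhL2
  have hmem : ∀ j, MemLp (B j) 2 P := by
    intro j
    induction j with
    | zero => exact MemLp.zero'
    | succ j ih =>
      rw [hsucc]
      exact (hfP j).add (memLp_mul_of_indepFun (hhP j) ih (hind j)).1
  refine ⟨hmem, ?_⟩
  set s := ∫ x, h x ^ 2 ∂ν with hs
  have hs0 : 0 ≤ s := integral_nonneg fun x => sq_nonneg _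
  set F := ∫ x, f x ^ 2 ∂ν with hF
  have hF0 : 0 ≤ F := integral_nonneg fun x => sq_nonneg _
  -- `(x + y) ^ 2 ≤ (1 + 1 / e) * x ^ 2 + (1 + e) * y ^ 2` with `(1 + e) * s ≤ (1 + s) / 2`
  set e := (1 - s) / 2 with he
  have he0 : 0 < e := by rw [he]; linarith
  set D := (1 + 1 / e) * F with hD
  have hD0 : 0 ≤ D := by positivity
  -- The fixed point of `b ↦ D + (1 + s) / 2 * b`.
  refine ⟨D * (2 / (1 - s)), fun j => ?_⟩
  change ∫ ω, B j ω ^ 2 ∂P ≤ _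
  have h1s : 0 < 1 - s := by linarith
  induction j with
  | zero =>
    simp only [hB, affineRec]
    simp only [ne_eq, OfNat.ofNat_ne_zero, not_false_eq_true, zero_pow, integral_zero]
    positivity
  | succ j ih =>
    obtain ⟨hm, hi⟩ := memLp_mul_of_indepFun (hhP j) (hmem j) (hind j)
    have hfi : ∫ ω, f (ξ j ω) ^ 2 ∂P = F :=
      (hlaw j).integral_comp (f := fun x => f x ^ 2) (hf.pow_const 2).aestronglyMeasurable
    have hhi : ∫ ω, h (ξ j ω) ^ 2 ∂P = s :=
      (hlaw j).integral_comp (f := fun x => h x ^ 2) (hh.pow_const 2).aestronglyMeasurable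
    rw [hhi] at hi
    have hle : ∫ ω, B (j + 1) ω ^ 2 ∂P ≤ D + (1 + e) * (s * ∫ ω, B j ω ^ 2 ∂P) := by
      calc ∫ ω, B (j + 1) ω ^ 2 ∂P
          ≤ ∫ ω, ((1 + 1 / e) * f (ξ j ω) ^ 2 + (1 + e) * (h (ξ j ω) * B j ω) ^ 2) ∂P := by
            refine integral_mono (hmem (j + 1)).integrable_sq
              (((hfP j).integrable_sq.const_mul _).add (hm.integrable_sq.const_mul _)) fun ω => ?_
            change (f (ξ j ω) + h (ξ j ω) * B j ω) ^ 2 ≤ _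
            set x := f (ξ j ω)
            set y := h (ξ j ω) * B j ω
            have : (1 + 1 / e) * x ^ 2 + (1 + e) * y ^ 2 - (x + y) ^ 2 = (x - e * y) ^ 2 / e := by
              field_simp
              ring
            have h2 : 0 ≤ (x - e * y) ^ 2 / e := by positivity
            linarith
        _ = _ := by
            rw [integral_add ((hfP j).integrable_sq.const_mul _) (hm.integrable_sq.const_mul _),
              integral_const_mul, integral_const_mul, hi, hfi]
    have h3 : (1 + e) * s ≤ (1 + s) / 2 := by rw [he]; nlinarith
    have hb0 : 0 ≤ ∫ ω, B j ω ^ 2 ∂P := integral_nonneg fun ω => sq_nonneg _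
    calc _ ≤ D + (1 + e) * (s * ∫ ω, B j ω ^ 2 ∂P) := hle
      _ = D + ((1 + e) * s) * ∫ ω, B j ω ^ 2 ∂P := by ring
      _ ≤ D + ((1 + s) / 2) * (D * (2 / (1 - s))) := by gcongr
      _ = D * (2 / (1 - s)) := by field_simp; ring

/-- Given the past, the recursion term is known and the centered factor is independent, so the
products are martingale differences. -/
theorem ae_tendsto_average_centered_mul_affineRec (hξ : ∀ j, Measurable (ξ j))
    (hlaw : ∀ j, HasLaw (ξ j) ν P) (hindep : iIndepFun ξ P)
    (hf : Measurable f) (hh : Measurable h) (hfL2 : MemLp f 2 ν) (hhL2 : MemLp h 2 ν)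
    (hh2 : ∫ x, h x ^ 2 ∂ν < 1) (hg : Measurable g) (hgL2 : MemLp g 2 ν)
    (hg0 : ∫ x, g x ∂ν = 0) :
    ∀ᵐ ω ∂P, Tendsto (fun N : ℕ => (∑ j ∈ Finset.range N,
      g (ξ j ω) * affineRec (fun l => f (ξ l ω)) (fun l => h (ξ l ω)) 0 j) / N) atTop (𝓝 0) := by
  have := hindep.isProbabilityMeasure
  obtain ⟨hmem, C, hC⟩ := memLp_affineRec_and_exists_bound hξ hlaw hindep hf hh hfL2 hhL2 hh2
  have hξ' := fun j => (hξ j).stronglyMeasurable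
  have hadB := stronglyMeasurable_affineRec hξ' hf hh
  have hindB := indepFun_affineRec hξ hindep hf hh
  set B : ℕ → Ω → ℝ := fun j ω => affineRec (fun l => f (ξ l ω)) (fun l => h (ξ l ω)) 0 j with hB
  have hgP := fun j => memLp_comp_of_hasLaw (hlaw j) hgL2
  have hprod := fun j => memLp_mul_of_indepFun (hgP j) (hmem j)
    ((hindB j).comp hg measurable_id)
  have hgad : ∀ j, StronglyMeasurable[Filtration.natural ξ hξ' j] (fun ω => g (ξ j ω)) := fun j =>
    (hg.comp (Filtration.stronglyAdapted_natural hξ' j).measurable).stronglyMeasurable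
  refine ae_tendsto_average_of_martingale_difference (ℱ := Filtration.natural ξ hξ')
    (d := fun j ω => g (ξ j ω) * B j ω) (C := (∫ x, g x ^ 2 ∂ν) * C) ?_ (fun j => (hprod j).1) ?_ ?_
  · intro j
    refine (hgad j).mul ?_
    cases j with
    | zero => exact stronglyMeasurable_const
    | succ j => exact (hadB j).mono ((Filtration.natural ξ hξ').mono j.le_succ)
  · intro j
    have h1 := condExp_mul_of_stronglyMeasurable_right (μ := P) (f := fun ω => g (ξ (j + 1) ω))
      (hadB j) ((hprod (j + 1)).1.integrable (by norm_num)) ((hgP (j + 1)).integrable (by norm_num))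
    have h2 : P[fun ω => g (ξ (j + 1) ω) | Filtration.natural ξ hξ' j] =ᵐ[P]
        fun _ => P[fun ω => g (ξ (j + 1) ω)] :=
      condExp_indep_eq (hξ (j + 1)).comap_le (Filtration.le _ _)
        (hg.comp (comap_measurable (ξ (j + 1)))).stronglyMeasurable
        (hindep.indep_comap_natural_of_lt hξ' j.lt_succ_self)
    have h3 : P[fun ω => g (ξ (j + 1) ω)] = 0 := by
      rw [← hg0]
      exact (hlaw (j + 1)).integral_comp hg.aestronglyMeasurable
    refine h1.trans ?_
    filter_upwards [h2] with ω h4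
    simp [h4, h3]
  · intro j
    have h5 : ∫ ω, g (ξ j ω) ^ 2 ∂P = ∫ x, g x ^ 2 ∂ν :=
      (hlaw j).integral_comp (f := fun x => g x ^ 2) (hg.pow_const 2).aestronglyMeasurable
    rw [(hprod j).2, h5]
    exact mul_le_mul_of_nonneg_left (hC j) (integral_nonneg fun x => sq_nonneg _)

/-- Ergodic averages along the affine recursion driven by i.i.d. inputs. -/
theorem ae_tendsto_average_mul_affineRec (hξ : ∀ j, Measurable (ξ j))
    (hlaw : ∀ j, HasLaw (ξ j) ν P) (hindep : iIndepFun ξ P)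
    (hf : Measurable f) (hh : Measurable h) (hfL2 : MemLp f 2 ν)
    (hh01 : ∀ x, h x ∈ Set.Icc (0 : ℝ) 1) (hh1 : ∫ x, h x ∂ν < 1)
    (hg : Measurable g) (hgL2 : MemLp g 2 ν) :
    ∀ᵐ ω ∂P, Tendsto (fun N : ℕ => (∑ j ∈ Finset.range N,
      g (ξ j ω) * affineRec (fun l => f (ξ l ω)) (fun l => h (ξ l ω)) 0 j) / N) atTop
      (𝓝 ((∫ x, g x ∂ν) * ((∫ x, f x ∂ν) / (1 - ∫ x, h x ∂ν)))) := by
  have := hindep.isProbabilityMeasure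
  have : IsProbabilityMeasure ν := (hlaw 0).isProbabilityMeasure_iff.1 this
  have hhL2 : MemLp h 2 ν := MemLp.of_bound hh.aestronglyMeasurable 1 (ae_of_all _ fun x => by
    rw [Real.norm_eq_abs, abs_le]; exact ⟨by linarith [(hh01 x).1], (hh01 x).2⟩)
  have hh2 : ∫ x, h x ^ 2 ∂ν < 1 := by
    refine lt_of_le_of_lt (integral_mono hhL2.integrable_sq
      (hhL2.integrable (by norm_num)) fun x => ?_) hh1
    have := hh01 x
    simp only [Set.mem_Icc] at this
    nlinarith [this.1, this.2]
  set q := ∫ x, h x ∂ν with hq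
  set m := ∫ x, g x ∂ν with hm
  have hcent : ∀ {φ : E → ℝ}, MemLp φ 2 ν → ∫ x, (φ x - ∫ y, φ y ∂ν) ∂ν = 0 := by
    intro φ hφ
    rw [integral_sub (hφ.integrable (by norm_num)) (integrable_const _)]
    simp
  obtain ⟨hmem, C, hC⟩ := memLp_affineRec_and_exists_bound hξ hlaw hindep hf hh hfL2 hhL2 hh2
  filter_upwards [ae_tendsto_average_comp hξ hlaw hindep hf (hfL2.integrable (by norm_num)),
    ae_tendsto_div_of_integral_sq_le hmem hC,
    ae_tendsto_average_centered_mul_affineRec hξ hlaw hindep hf hh hfL2 hhL2 hh2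
      (hg.sub_const m) (hgL2.sub (memLp_const m)) (hcent hgL2),
    ae_tendsto_average_centered_mul_affineRec hξ hlaw hindep hf hh hfL2 hhL2 hh2
      (hh.sub_const q) (hhL2.sub (memLp_const q)) (hcent hhL2)] with ω h1 h2 h3 h4
  set B : ℕ → ℝ := affineRec (fun l => f (ξ l ω)) (fun l => h (ξ l ω)) 0 with hB
  have hq1 : 1 - q ≠ 0 := by linarith
  -- Sum the recursion with `h` written as `q + (h - q)`. After division by `N`, the centered sum
  -- and the boundary term `B N` vanish in the limit.
  have hident : ∀ N : ℕ, (1 - q) * ∑ j ∈ Finset.range N, B j =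
      ∑ j ∈ Finset.range N, f (ξ j ω) + ∑ j ∈ Finset.range N, (h (ξ j ω) - q) * B j - B N := by
    intro N
    induction N with
    | zero => simp [hB, affineRec]
    | succ N ih =>
      have : B (N + 1) = f (ξ N ω) + h (ξ N ω) * B N := rfl
      rw [Finset.sum_range_succ, Finset.sum_range_succ, Finset.sum_range_succ, mul_add, ih, this]
      ring
  have hBavg : Tendsto (fun N : ℕ => (∑ j ∈ Finset.range N, B j) / N) atTop
      (𝓝 ((∫ x, f x ∂ν) / (1 - q))) := by
    have h5 := ((h1.add h4).sub h2).div_const (1 - q)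
    simp only [add_zero, sub_zero] at h5
    refine h5.congr fun N => ?_
    have h6 := hident N
    rw [← add_div, ← sub_div, ← h6]
    field_simp
  have h7 := h3.add (hBavg.const_mul m)
  rw [zero_add] at h7
  refine h7.congr fun N => ?_
  rw [← mul_div_assoc, ← add_div, Finset.mul_sum, ← Finset.sum_add_distrib]
  congr 1
  exact Finset.sum_congr rfl fun j _ => by ring

end IID

/-! ### From averages over cycles to averages over time -/

/-- Time averages of a monotone function can be computed along a monotone sequence of times. -/
theorem tendsto_div_of_tendsto_along {F : ℝ → ℝ} (hF : MonotoneOn F (Set.Ici 0)) (hF0 : F 0 = 0)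
    {T : ℕ → ℝ} (hT : Monotone T) (hT0 : T 0 = 0) {μ α : ℝ} (hμ : 0 < μ)
    (hTlim : Tendsto (fun N : ℕ => T N / N) atTop (𝓝 μ))
    (hFlim : Tendsto (fun N : ℕ => F (T N) / N) atTop (𝓝 α)) :
    Tendsto (fun τ => F τ / τ) atTop (𝓝 (α / μ)) := by
  have hTnn : ∀ N, 0 ≤ T N := fun N => hT0 ▸ hT (Nat.zero_le N)
  have hFnn : ∀ t, 0 ≤ t → 0 ≤ F t := fun t ht => hF0 ▸ hF Set.self_mem_Ici ht ht
  have hTtop : Tendsto T atTop atTop := by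
    have h := hTlim.pos_mul_atTop hμ tendsto_natCast_atTop_atTop
    refine h.congr' ?_
    filter_upwards [eventually_gt_atTop 0] with N hN
    have : (N : ℝ) ≠ 0 := by positivity
    field_simp
  have hex : ∀ τ : ℝ, ∃ N : ℕ, 0 ≤ τ → T N ≤ τ ∧ τ < T (N + 1) := by
    intro τ
    by_cases hτ : 0 ≤ τ
    · have h1 : ∃ N, τ < T N := (hTtop.eventually_gt_atTop τ).exists
      classical
      have h2 := Nat.find_spec h1
      have h3 : Nat.find h1 ≠ 0 := fun h => by
        rw [h, hT0] at h2
        linarith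
      obtain ⟨N, hN⟩ := Nat.exists_eq_succ_of_ne_zero h3
      refine ⟨N, fun _ => ⟨?_, ?_⟩⟩
      · exact not_lt.1 (Nat.find_min h1 (by omega))
      · rwa [hN] at h2
    · exact ⟨0, fun h => absurd h hτ⟩
  choose n hn using hex
  have hntop : Tendsto n atTop atTop := by
    refine tendsto_atTop.2 fun M => ?_
    filter_upwards [eventually_ge_atTop (max 0 (T M))] with τ hτ
    have h1 := (hn τ ((le_max_left _ _).trans hτ)).2
    by_contra h2
    exact absurd (hT (by omega : n τ + 1 ≤ M)) (not_le.2 (lt_of_le_of_lt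
      ((le_max_right _ _).trans hτ) h1))
  have hshift : Tendsto (fun N : ℕ => ((N : ℝ) + 1) / N) atTop (𝓝 1) := by
    have h := (tendsto_const_nhds (x := (1 : ℝ))).add (tendsto_one_div_atTop_nhds_zero_nat (𝕜 := ℝ))
    rw [add_zero] at h
    refine h.congr' ?_
    filter_upwards [eventually_gt_atTop 0] with N hN
    have : (N : ℝ) ≠ 0 := by positivity
    field_simp
  have hT1 : Tendsto (fun N : ℕ => T (N + 1) / N) atTop (𝓝 μ) := by
    have h := ((tendsto_add_atTop_iff_nat 1).2 hTlim).mul hshift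
    rw [mul_one] at h
    refine h.congr' ?_
    filter_upwards [eventually_gt_atTop 0] with N hN
    have : (N : ℝ) ≠ 0 := by positivity
    push_cast
    field_simp
  have hF1 : Tendsto (fun N : ℕ => F (T (N + 1)) / N) atTop (𝓝 α) := by
    have h := ((tendsto_add_atTop_iff_nat 1).2 hFlim).mul hshift
    rw [mul_one] at h
    refine h.congr' ?_
    filter_upwards [eventually_gt_atTop 0] with N hN
    have : (N : ℝ) ≠ 0 := by positivity
    push_cast
    field_simp
  -- With `T n ≤ τ < T (n + 1)`, the quotient `F τ / τ` lies between `F (T n) / T (n + 1)` and `F (T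
  -- (n + 1)) / T n`.
  have hlow := ((hFlim.div hT1 hμ.ne').comp hntop)
  have hupp := ((hF1.div hTlim hμ.ne').comp hntop)
  refine tendsto_of_tendsto_of_tendsto_of_le_of_le' hlow hupp ?_ ?_
  · filter_upwards [hntop.eventually_gt_atTop 0, eventually_gt_atTop 0] with τ h1 h2
    have h3 : (n τ : ℝ) ≠ 0 := by positivity
    obtain ⟨h4, h5⟩ := hn τ h2.le
    simp only [Function.comp_apply, Pi.div_apply, div_div_div_cancel_right₀ h3]
    exact div_le_div₀ (hFnn _ h2.le) (hF (hTnn _) h2.le h4) h2 h5.le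
  · filter_upwards [hntop.eventually_gt_atTop 0, eventually_gt_atTop 0,
      hntop.eventually (hTtop.eventually_gt_atTop 0)] with τ h1 h2 h6
    have h3 : (n τ : ℝ) ≠ 0 := by positivity
    obtain ⟨h4, h5⟩ := hn τ h2.le
    simp only [Function.comp_apply, Pi.div_apply, div_div_div_cancel_right₀ h3]
    exact div_le_div₀ (hFnn _ (hTnn _)) (hF h2.le (hTnn _) h5.le) h6 h4

/-! ### The age along a single sample path -/

section Path

/-- Start of cycle `j` when the cycles have the lengths `y`. -/
def cycleStart (y : ℕ → ℝ) (j : ℕ) : ℝ := ∑ l ∈ Finset.range j, y l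

/-- Timestamp held at time `t` by a node with link delays `x`. -/
noncomputable def heldTimestamp (y x : ℕ → ℝ) (u : ℝ) (t : ℝ) : ℝ :=
  sSup (insert u {s : ℝ | ∃ j : ℕ, x j ≤ y j ∧ cycleStart y j + x j ≤ t ∧ s = cycleStart y j})

/-- Indicator of the failure to deliver update `j`. -/
noncomputable def missed (y x : ℕ → ℝ) (j : ℕ) : ℝ := if x j ≤ y j then 0 else 1

/-- Age at the start of cycle `j` of the update held by the node. -/
noncomputable def backlog (y x : ℕ → ℝ) (u : ℝ) : ℕ → ℝ := affineRec y (missed y x) (-u)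

variable {y x : ℕ → ℝ} {u : ℝ}

theorem cycleStart_zero : cycleStart y 0 = 0 := by simp [cycleStart]

theorem cycleStart_succ (j : ℕ) : cycleStart y (j + 1) = cycleStart y j + y j := by
  simp [cycleStart, Finset.sum_range_succ]

theorem monotone_cycleStart (hy : ∀ j, 0 ≤ y j) : Monotone (cycleStart y) :=
  monotone_nat_of_le_succ fun j => by rw [cycleStart_succ]; linarith [hy j]

theorem cycleStart_nonneg (hy : ∀ j, 0 ≤ y j) (j : ℕ) : 0 ≤ cycleStart y j :=
  Finset.sum_nonneg fun l _ => hy l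

theorem backlog_succ (j : ℕ) :
    backlog y x u (j + 1) = y j + missed y x j * backlog y x u j := rfl

theorem bddAbove_received (hx : ∀ j, 0 ≤ x j) (t : ℝ) : BddAbove
    (insert u {s : ℝ | ∃ j : ℕ, x j ≤ y j ∧ cycleStart y j + x j ≤ t ∧ s = cycleStart y j}) := by
  refine BddAbove.insert u ⟨t, ?_⟩
  rintro s ⟨j, -, h, rfl⟩
  linarith [hx j]

/-- Monotonicity yields the local integrability of the age directly. -/
theorem monotone_heldTimestamp (hx : ∀ j, 0 ≤ x j) : Monotone (heldTimestamp y x u) := by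
  intro s t hst
  refine csSup_le_csSup (bddAbove_received hx t) (Set.insert_nonempty _ _)
    (Set.insert_subset_insert ?_)
  rintro _ ⟨j, h1, h2, h3⟩
  exact ⟨j, h1, h2.trans hst, h3⟩

theorem heldTimestamp_le (hx : ∀ j, 0 ≤ x j) (hu : u ≤ 0) {t : ℝ} (ht : 0 ≤ t) :
    heldTimestamp y x u t ≤ t := by
  refine csSup_le (Set.insert_nonempty _ _) ?_
  rintro s (rfl | ⟨j, -, h, rfl⟩)
  · exact hu.trans ht
  · linarith [hx j]

/-- Identifies the recursively defined backlog with the true age: a delivery puts the newest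
timestamp into the set, a miss leaves the set unchanged. -/
theorem isGreatest_cycleStart_sub_backlog (hy : ∀ j, 0 ≤ y j) (hu : u ≤ 0) (j : ℕ) :
    IsGreatest (insert u {s : ℝ | ∃ l < j, x l ≤ y l ∧ s = cycleStart y l})
      (cycleStart y j - backlog y x u j) := by
  induction j with
  | zero => simp [cycleStart_zero, backlog, affineRec]
  | succ j ih =>
    have h0 : cycleStart y (j + 1) - backlog y x u (j + 1) =
        cycleStart y j - missed y x j * backlog y x u j := by
      rw [cycleStart_succ, backlog_succ]
      ring
    rw [h0]
    by_cases h : x j ≤ y j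
    · simp only [missed, if_pos h, zero_mul, sub_zero]
      refine ⟨Or.inr ⟨j, j.lt_succ_self, h, rfl⟩, ?_⟩
      rintro s (rfl | ⟨l, hl, -, rfl⟩)
      · exact hu.trans (cycleStart_nonneg hy j)
      · exact monotone_cycleStart hy (by omega)
    · simp only [missed, if_neg h, one_mul]
      refine ⟨?_, ?_⟩
      · rcases ih.1 with h1 | ⟨l, hl, h1, h2⟩
        · exact Or.inl h1
        · exact Or.inr ⟨l, by omega, h1, h2⟩
      · rintro s (rfl | ⟨l, hl, h1, rfl⟩)
        · exact ih.2 (Or.inl rfl)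
        · rcases Nat.lt_succ_iff_lt_or_eq.1 hl with h3 | rfl
          · exact ih.2 (Or.inr ⟨l, h3, h1, rfl⟩)
          · exact absurd h1 h

/-- Within a cycle only update `j` can change the held timestamp: earlier deliveries were complete
when the cycle began, since `x l ≤ y l`, and later updates are not yet generated. -/
theorem heldTimestamp_eq (hy : ∀ j, 0 ≤ y j) (hx : ∀ j, 0 ≤ x j) (hu : u ≤ 0) {j : ℕ} {t : ℝ}
    (h1 : cycleStart y j ≤ t) (h2 : t < cycleStart y (j + 1)) :
    heldTimestamp y x u t = if cycleStart y j + x j ≤ t then cycleStart y j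
      else cycleStart y j - backlog y x u j := by
  have hmono := monotone_cycleStart hy
  have hle : ∀ l, cycleStart y l + x l ≤ t → l ≤ j := by
    intro l hl
    by_contra h
    have := hmono (by omega : j + 1 ≤ l)
    linarith [hx l]
  split_ifs with h
  -- An arrival before the end of the cycle forces `x j ≤ y j`, so update `j` counts as delivered.
  · refine IsGreatest.csSup_eq ⟨Or.inr ⟨j, ?_, h, rfl⟩, ?_⟩
    · rw [cycleStart_succ] at h2
      linarith
    · rintro s (rfl | ⟨l, -, h3, rfl⟩)
      · exact hu.trans (cycleStart_nonneg hy j)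
      · exact hmono (hle l h3)
  · have hg := isGreatest_cycleStart_sub_backlog (x := x) hy hu j
    refine IsGreatest.csSup_eq ⟨?_, ?_⟩
    · rcases hg.1 with h3 | ⟨l, hl, h3, h4⟩
      · exact Or.inl h3
      · refine Or.inr ⟨l, h3, ?_, h4⟩
        have := hmono (Nat.succ_le_of_lt hl)
        rw [Nat.succ_eq_add_one, cycleStart_succ] at this
        linarith
    · rintro s (rfl | ⟨l, h3, h4, rfl⟩)
      · exact hg.2 (Or.inl rfl)
      · refine hg.2 (Or.inr ⟨l, lt_of_le_of_ne (hle l h4) ?_, h3, rfl⟩)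
        rintro rfl
        exact h h4

theorem intervalIntegrable_age (hx : ∀ j, 0 ≤ x j) (a b : ℝ) :
    IntervalIntegrable (fun t => t - heldTimestamp y x u t) volume a b :=
  intervalIntegral.intervalIntegrable_id.sub (monotone_heldTimestamp hx).intervalIntegrable

/-- A triangle of side `y j` plus a rectangle of height `backlog` and width `min (x j) (y j)`. In a
missed cycle the width is `y j` and the second piece of the integral is empty. -/
theorem integral_age_cycle (hy : ∀ j, 0 ≤ y j) (hx : ∀ j, 0 ≤ x j) (hu : u ≤ 0) (j : ℕ) :
    ∫ t in cycleStart y j..cycleStart y (j + 1), (t - heldTimestamp y x u t) =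
      y j ^ 2 / 2 + min (x j) (y j) * backlog y x u j := by
  set c := cycleStart y j + min (x j) (y j) with hc
  have hm0 : 0 ≤ min (x j) (y j) := le_min (hx j) (hy j)
  have h1 : cycleStart y j ≤ c := by rw [hc]; linarith
  have h2 : c ≤ cycleStart y (j + 1) := by
    rw [cycleStart_succ, hc]; linarith [min_le_right (x j) (y j)]
  rw [← intervalIntegral.integral_add_adjacent_intervals (intervalIntegrable_age hx _ c)
    (intervalIntegrable_age hx c _)]
  have e1 : ∫ t in cycleStart y j..c, (t - heldTimestamp y x u t) =
      ∫ t in cycleStart y j..c, (t - (cycleStart y j - backlog y x u j)) := by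
    refine intervalIntegral.integral_congr_ae ?_
    filter_upwards [compl_mem_ae_iff.2 (measure_singleton (μ := volume) c)] with t ht1 ht2
    rw [Set.uIoc_of_le h1] at ht2
    have ht3 : t < c := lt_of_le_of_ne ht2.2 ht1
    rw [heldTimestamp_eq hy hx hu ht2.1.le (ht3.trans_le h2), if_neg]
    rw [not_le]
    refine ht3.trans_le ?_
    rw [hc]
    linarith [min_le_left (x j) (y j)]
  have e2 : ∫ t in c..cycleStart y (j + 1), (t - heldTimestamp y x u t) =
      ∫ t in c..cycleStart y (j + 1), (t - cycleStart y j) := by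
    refine intervalIntegral.integral_congr_ae ?_
    filter_upwards [compl_mem_ae_iff.2 (measure_singleton (μ := volume) (cycleStart y (j + 1)))]
      with t ht1 ht2
    rw [Set.uIoc_of_le h2] at ht2
    have ht3 : t < cycleStart y (j + 1) := lt_of_le_of_ne ht2.2 ht1
    rw [heldTimestamp_eq hy hx hu (h1.trans ht2.1.le) ht3, if_pos]
    have ht4 := ht2.1
    rw [cycleStart_succ] at ht3
    rw [hc] at ht4
    rcases min_choice (x j) (y j) with h | h <;> rw [h] at ht4 <;> linarith
  rw [e1, e2, intervalIntegral.integral_sub intervalIntegral.intervalIntegrable_id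
    intervalIntegrable_const, intervalIntegral.integral_sub intervalIntegral.intervalIntegrable_id
    intervalIntegrable_const]
  simp only [integral_id, intervalIntegral.integral_const, smul_eq_mul, cycleStart_succ, hc]
  ring

theorem integral_age_eq_sum (hy : ∀ j, 0 ≤ y j) (hx : ∀ j, 0 ≤ x j) (hu : u ≤ 0) (N : ℕ) :
    ∫ t in (0 : ℝ)..cycleStart y N, (t - heldTimestamp y x u t) =
      ∑ j ∈ Finset.range N, (y j ^ 2 / 2 + min (x j) (y j) * backlog y x u j) := by
  have h := intervalIntegral.sum_integral_adjacent_intervals (μ := volume) (a := cycleStart y)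
    (n := N) (f := fun t => t - heldTimestamp y x u t) fun k _ => intervalIntegrable_age hx _ _
  rw [cycleStart_zero] at h
  rw [← h]
  exact Finset.sum_congr rfl fun j _ => integral_age_cycle hy hx hu j

/-- The backlog forgets its initial value at the first delivery. -/
theorem backlog_eq_of_delivered {j₀ : ℕ} (h : x j₀ ≤ y j₀) {j : ℕ} (hj : j₀ < j) :
    backlog y x u j = affineRec y (missed y x) 0 j := by
  induction j, hj using Nat.le_induction with
  | base => simp [backlog, affineRec, missed, h]
  | succ j hj ih => rw [backlog_succ, ih, affineRec]

theorem hasTimeAverage_age (hy : ∀ j, 0 ≤ y j) (hx : ∀ j, 0 ≤ x j) (hu : u ≤ 0)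
    (hdel : ∃ j, x j ≤ y j) {m s c : ℝ} (hm : 0 < m)
    (hmlim : Tendsto (fun N : ℕ => (∑ j ∈ Finset.range N, y j) / N) atTop (𝓝 m))
    (hslim : Tendsto (fun N : ℕ => (∑ j ∈ Finset.range N, y j ^ 2) / N) atTop (𝓝 s))
    (hclim : Tendsto (fun N : ℕ => (∑ j ∈ Finset.range N,
      min (x j) (y j) * affineRec y (missed y x) 0 j) / N) atTop (𝓝 c)) :
    HasTimeAverage (fun t => t - heldTimestamp y x u t) ((s / 2 + c) / m) := by
  refine ⟨fun τ _ => intervalIntegrable_age hx _ _, ?_⟩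
  obtain ⟨j₀, hj₀⟩ := hdel
  -- The error made by starting the backlog at `0` instead of `-u`. It vanishes after the first
  -- delivery, so the initial timestamp may be any function of the sample point with values `≤ 0`.
  set δ : ℕ → ℝ := fun j =>
    min (x j) (y j) * (backlog y x u j - affineRec y (missed y x) 0 j) with hδ
  have hδlim : Tendsto (fun N : ℕ => (∑ j ∈ Finset.range N, δ j) / N) atTop (𝓝 0) := by
    refine Tendsto.congr' ?_ (tendsto_const_div_atTop_nhds_zero_nat
      (∑ j ∈ Finset.range (j₀ + 1), δ j))
    filter_upwards [eventually_ge_atTop (j₀ + 1)] with N hN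
    congr 1
    refine Finset.sum_subset (Finset.range_mono hN) fun j _ hj => ?_
    rw [Finset.mem_range, not_lt] at hj
    simp only [hδ]
    rw [backlog_eq_of_delivered hj₀ hj, sub_self, mul_zero]
  set F : ℝ → ℝ := fun τ => ∫ t in (0 : ℝ)..τ, (t - heldTimestamp y x u t) with hF
  have hFmono : MonotoneOn F (Set.Ici 0) := by
    intro a ha b hb hab
    have h := intervalIntegral.integral_add_adjacent_intervals
      (intervalIntegrable_age (y := y) (u := u) hx 0 a) (intervalIntegrable_age hx a b)
    have h2 : 0 ≤ ∫ t in a..b, (t - heldTimestamp y x u t) :=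
      intervalIntegral.integral_nonneg hab fun t ht =>
        sub_nonneg.2 (heldTimestamp_le hx hu (le_trans ha ht.1))
    simp only [hF]
    linarith
  have hFlim : Tendsto (fun N : ℕ => F (cycleStart y N) / N) atTop (𝓝 (s / 2 + c)) := by
    have h := ((hslim.div_const 2).add hclim).add hδlim
    rw [add_zero] at h
    refine h.congr fun N => ?_
    simp only [hF]
    rw [integral_age_eq_sum hy hx hu, div_right_comm, ← add_div, ← add_div, Finset.sum_div,
      ← Finset.sum_add_distrib, ← Finset.sum_add_distrib]
    congr 1
    refine Finset.sum_congr rfl fun j _ => ?_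
    simp only [hδ]
    ring
  have h := tendsto_div_of_tendsto_along hFmono (by simp [hF]) (monotone_cycleStart hy)
    cycleStart_zero hm hmlim hFlim
  refine h.congr fun τ => ?_
  simp only [hF]
  ring

end Path

/-! ### Moments of the maximum of exponential variables -/

/-- Tail of the largest of `k` independent exponential variables. -/
noncomputable def expMaxTail (r : ℝ) (k : ℕ) (t : ℝ) : ℝ := 1 - (1 - Real.exp (-(r * t))) ^ k

theorem genHarmonic_succ (s k : ℕ) :
    genHarmonic s (k + 1) = genHarmonic s k + 1 / ((k : ℝ) + 1) ^ s := by
  simp [genHarmonic, Finset.sum_Icc_succ_top]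

theorem genHarmonic_pos (s : ℕ) {k : ℕ} (hk : 1 ≤ k) : 0 < genHarmonic s k :=
  Finset.sum_pos (fun j hj => by
    have : 0 < j := (Finset.mem_Icc.1 hj).1
    positivity) ⟨1, by simp [hk]⟩

/-- The added term is the probability that the new variable alone exceeds `t`. -/
theorem expMaxTail_succ (r : ℝ) (k : ℕ) (t : ℝ) : expMaxTail r (k + 1) t =
    expMaxTail r k t + Real.exp (-(r * t)) * (1 - Real.exp (-(r * t))) ^ k := by
  simp only [expMaxTail]
  ring

theorem hasDerivAt_expMaxTail_succ (r : ℝ) (k : ℕ) (t : ℝ) :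
    HasDerivAt (expMaxTail r (k + 1))
      (-((k + 1) * r * (Real.exp (-(r * t)) * (1 - Real.exp (-(r * t))) ^ k))) t := by
  have h1 : HasDerivAt (fun t => 1 - Real.exp (-(r * t))) (r * Real.exp (-(r * t))) t := by
    have := (hasDerivAt_neg_exp_mul_exp (r := r) (x := t)).const_add 1
    simpa [sub_eq_add_neg] using this
  have h2 := (h1.pow (k + 1)).const_sub 1
  refine h2.congr_deriv ?_
  push_cast
  ring

theorem exp_neg_mem_Icc {r t : ℝ} (hr : 0 < r) (ht : 0 ≤ t) :
    Real.exp (-(r * t)) ∈ Set.Icc (0 : ℝ) 1 :=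
  ⟨(Real.exp_pos _).le, Real.exp_le_one_iff.2 (by nlinarith)⟩

theorem expMaxTail_nonneg {r t : ℝ} (hr : 0 < r) (ht : 0 ≤ t) (k : ℕ) : 0 ≤ expMaxTail r k t := by
  have h := exp_neg_mem_Icc hr ht
  have := pow_le_one₀ (n := k) (by linarith [h.2] : 0 ≤ 1 - Real.exp (-(r * t))) (by linarith [h.1])
  simp only [expMaxTail]
  linarith

theorem tendsto_expMaxTail {r : ℝ} (hr : 0 < r) (k : ℕ) :
    Tendsto (expMaxTail r k) atTop (𝓝 0) := by
  have h1 : Tendsto (fun t : ℝ => Real.exp (-(r * t))) atTop (𝓝 0) :=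
    Real.tendsto_exp_neg_atTop_nhds_zero.comp (tendsto_id.const_mul_atTop hr)
  have h2 := ((h1.const_sub 1).pow k).const_sub 1
  simp only [sub_zero, one_pow, sub_self] at h2
  exact h2

/-- Up to the factor `(k + 1) * r`, the integrand is the density of the largest of `k + 1`
variables. -/
theorem integral_exp_mul_one_sub_exp_pow {r : ℝ} (hr : 0 < r) (k : ℕ) :
    IntegrableOn (fun t => Real.exp (-(r * t)) * (1 - Real.exp (-(r * t))) ^ k) (Set.Ioi 0) ∧
    ∫ t in Set.Ioi 0, Real.exp (-(r * t)) * (1 - Real.exp (-(r * t))) ^ k =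
      1 / (r * ((k : ℝ) + 1)) := by
  have hd : ∀ t ∈ Set.Ici (0 : ℝ), HasDerivAt (fun t => -(1 / (r * ((k : ℝ) + 1))) *
      expMaxTail r (k + 1) t) (Real.exp (-(r * t)) * (1 - Real.exp (-(r * t))) ^ k) t := by
    intro t _
    refine ((hasDerivAt_expMaxTail_succ r k t).const_mul _).congr_deriv ?_
    have : (k : ℝ) + 1 ≠ 0 := by positivity
    field_simp
  have hnn : ∀ t ∈ Set.Ioi (0 : ℝ),
      0 ≤ Real.exp (-(r * t)) * (1 - Real.exp (-(r * t))) ^ k := fun t ht => by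
    have h := exp_neg_mem_Icc hr (le_of_lt ht)
    exact mul_nonneg h.1 (pow_nonneg (by linarith [h.2]) k)
  have hlim := (tendsto_expMaxTail hr (k + 1)).const_mul (-(1 / (r * ((k : ℝ) + 1))))
  refine ⟨integrableOn_Ioi_deriv_of_nonneg' hd hnn hlim, ?_⟩
  rw [integral_Ioi_of_hasDerivAt_of_nonneg' hd hnn hlim]
  simp [expMaxTail]

theorem integral_expMaxTail {r : ℝ} (hr : 0 < r) (k : ℕ) :
    IntegrableOn (expMaxTail r k) (Set.Ioi 0) ∧
    ∫ t in Set.Ioi 0, expMaxTail r k t = genHarmonic 1 k / r := by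
  induction k with
  | zero =>
    rw [show expMaxTail r 0 = fun _ => 0 by ext; simp [expMaxTail]]
    simp [genHarmonic]
  | succ k ih =>
    obtain ⟨h1, h2⟩ := integral_exp_mul_one_sub_exp_pow hr k
    rw [show expMaxTail r (k + 1) = fun t => expMaxTail r k t +
      Real.exp (-(r * t)) * (1 - Real.exp (-(r * t))) ^ k from funext (expMaxTail_succ r k)]
    refine ⟨ih.1.add h1, ?_⟩
    rw [integral_add ih.1 h1, ih.2, h2, genHarmonic_succ, pow_one, add_div, div_div, mul_comm r]

/-- The same density turns the increment of the second moment into `2 / ((k + 1) * r)` times the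
mean of the maximum of `k + 1` variables, which is already known. -/
theorem integral_two_mul_expMaxTail {r : ℝ} (hr : 0 < r) (k : ℕ) :
    IntegrableOn (fun t => 2 * t * expMaxTail r k t) (Set.Ioi 0) ∧
    ∫ t in Set.Ioi 0, 2 * t * expMaxTail r k t =
      (genHarmonic 1 k ^ 2 + genHarmonic 2 k) / r ^ 2 := by
  induction k with
  | zero => simp [expMaxTail, genHarmonic]
  | succ k ih =>
    set ρ : ℝ → ℝ := fun t => Real.exp (-(r * t)) * (1 - Real.exp (-(r * t))) ^ k with hρ
    have hk : (k : ℝ) + 1 ≠ 0 := by positivity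
    have hint : IntegrableOn (fun t => 2 * t * ρ t) (Set.Ioi 0) := by
      have h1 : IntegrableOn (fun t : ℝ => 2 * (t * Real.exp (-(r * t)))) (Set.Ioi 0) := by
        have h2 := integrableOn_rpow_mul_exp_neg_mul_rpow (p := 1) (s := 1) (by norm_num) one_pos hr
        simp only [Real.rpow_one, neg_mul] at h2
        exact h2.const_mul 2
      refine Integrable.mono' h1 (by fun_prop) ?_
      filter_upwards [ae_restrict_mem measurableSet_Ioi] with t ht
      have ht0 : 0 < t := ht
      have h := exp_neg_mem_Icc hr ht0.le
      have h3 := pow_le_one₀ (n := k) (by linarith [h.2] : 0 ≤ 1 - Real.exp (-(r * t)))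
        (by linarith [h.1])
      have h4 := pow_nonneg (by linarith [h.2] : 0 ≤ 1 - Real.exp (-(r * t))) k
      rw [Real.norm_of_nonneg (by simp only [hρ]; have := h.1; positivity)]
      simp only [hρ]
      rw [mul_assoc]
      gcongr
      exact mul_le_of_le_one_right h.1 h3
    have hsplit : (fun t => 2 * t * expMaxTail r (k + 1) t) =
        fun t => 2 * t * expMaxTail r k t + 2 * t * ρ t := by
      ext t
      rw [expMaxTail_succ]
      ring
    have hint1 : IntegrableOn (fun t => 2 * t * expMaxTail r (k + 1) t) (Set.Ioi 0) := by
      rw [hsplit]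
      exact ih.1.add hint
    refine ⟨hint1, ?_⟩
    -- integrate by parts the contribution of the additional variable
    have hd : ∀ t ∈ Set.Ici (0 : ℝ), HasDerivAt (fun t => 2 * t * expMaxTail r (k + 1) t)
        (2 * expMaxTail r (k + 1) t - (k + 1) * r * (2 * t * ρ t)) t := by
      intro t _
      refine (((hasDerivAt_id t).const_mul 2).mul (hasDerivAt_expMaxTail_succ r k t)).congr_deriv ?_
      simp only [hρ, id]
      ring
    obtain ⟨hI, hI'⟩ := integral_expMaxTail hr (k + 1)
    have hdint := (hI.const_mul 2).sub (hint.const_mul ((k + 1) * r))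
    have hlim := tendsto_zero_of_hasDerivAt_of_integrableOn_Ioi
      (fun t ht => hd t (Set.Ioi_subset_Ici_self ht)) hdint hint1
    have hval := integral_Ioi_of_hasDerivAt_of_tendsto' hd hdint hlim
    rw [integral_sub (hI.const_mul 2) (hint.const_mul ((k + 1) * r)), integral_const_mul,
      integral_const_mul, hI'] at hval
    have hval2 : ∫ t in Set.Ioi 0, 2 * t * ρ t =
        2 * genHarmonic 1 (k + 1) / (r ^ 2 * ((k : ℝ) + 1)) := by
      rw [eq_div_iff (by positivity)]
      have : r * (2 * (genHarmonic 1 (k + 1) / r)) = 2 * genHarmonic 1 (k + 1) := by field_simp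
      simp only [mul_zero, zero_mul, sub_zero] at hval
      rw [← this]
      linear_combination (-r) * hval
    rw [hsplit, integral_add ih.1 hint, ih.2, hval2, genHarmonic_succ, genHarmonic_succ]
    field_simp
    ring

/-- First two moments of a variable distributed as the largest of `k` independent exponential
variables. -/
theorem moments_of_cdf_eq_pow {α : Type*} [MeasurableSpace α] {ν : Measure α}
    [IsProbabilityMeasure ν] {r : ℝ} (hr : 0 < r) {k : ℕ} {Y : α → ℝ} (hY : Measurable Y)
    (hY0 : 0 ≤ᵐ[ν] Y)
    (hcdf : ∀ t, 0 ≤ t → ν.real {a | Y a ≤ t} = (1 - Real.exp (-(r * t))) ^ k) :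
    MemLp Y 2 ν ∧ ∫ a, Y a ∂ν = genHarmonic 1 k / r ∧
      ∫ a, Y a ^ 2 ∂ν = (genHarmonic 1 k ^ 2 + genHarmonic 2 k) / r ^ 2 := by
  have htail : ∀ t ∈ Set.Ioi (0 : ℝ), ν {a | t < Y a} = ENNReal.ofReal (expMaxTail r k t) := by
    intro t ht
    have h1 : {a | t < Y a} = {a | Y a ≤ t}ᶜ := by ext; simp
    rw [← ofReal_measureReal, h1, probReal_compl_eq_one_sub (measurableSet_le hY measurable_const),
      hcdf t (le_of_lt ht), expMaxTail]
  obtain ⟨hi1, he1⟩ := integral_expMaxTail hr k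
  obtain ⟨hi2, he2⟩ := integral_two_mul_expMaxTail hr k
  have hl1 : ∫⁻ a, ENNReal.ofReal (Y a) ∂ν = ENNReal.ofReal (genHarmonic 1 k / r) := by
    rw [lintegral_eq_lintegral_meas_lt ν hY0 hY.aemeasurable,
      setLIntegral_congr_fun measurableSet_Ioi htail, ← he1,
      ofReal_integral_eq_lintegral_ofReal hi1]
    filter_upwards [ae_restrict_mem measurableSet_Ioi] with t ht
    exact expMaxTail_nonneg hr (le_of_lt ht) k
  have hl2 : ∫⁻ a, ENNReal.ofReal (Y a ^ 2) ∂ν =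
      ENNReal.ofReal ((genHarmonic 1 k ^ 2 + genHarmonic 2 k) / r ^ 2) := by
    have h := lintegral_comp_eq_lintegral_meas_lt_mul ν hY0 hY.aemeasurable
      (g := fun t => 2 * t) (fun t _ => (continuous_const.mul continuous_id).intervalIntegrable _ _)
      (by
        filter_upwards [ae_restrict_mem measurableSet_Ioi] with t ht
        have : (0 : ℝ) < t := ht
        positivity)
    have h2 : ∀ b : ℝ, ∫ t in (0 : ℝ)..b, 2 * t = b ^ 2 := by
      intro b
      rw [intervalIntegral.integral_const_mul, integral_id]
      ring
    simp only [h2] at h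
    rw [h, ← he2, ofReal_integral_eq_lintegral_ofReal hi2]
    · refine setLIntegral_congr_fun measurableSet_Ioi fun t ht => ?_
      have ht0 : (0 : ℝ) < t := ht
      simp only [htail t ht]
      rw [← ENNReal.ofReal_mul (expMaxTail_nonneg hr ht0.le k), mul_comm]
    · filter_upwards [ae_restrict_mem measurableSet_Ioi] with t ht
      have ht0 : (0 : ℝ) < t := ht
      exact mul_nonneg (by positivity) (expMaxTail_nonneg hr ht0.le k)
  have hH1 : 0 ≤ genHarmonic 1 k := Finset.sum_nonneg fun j _ => by positivity
  have hH2 : 0 ≤ genHarmonic 2 k := Finset.sum_nonneg fun j _ => by positivity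
  have hsq : Integrable (fun a => Y a ^ 2) ν := by
    refine ⟨(hY.pow_const 2).aestronglyMeasurable, ?_⟩
    rw [hasFiniteIntegral_iff_ofReal (ae_of_all _ fun a => sq_nonneg _), hl2]
    exact ENNReal.ofReal_lt_top
  refine ⟨(memLp_two_iff_integrable_sq hY.aestronglyMeasurable).2 hsq, ?_, ?_⟩
  · rw [integral_eq_lintegral_of_nonneg_ae hY0 hY.aestronglyMeasurable, hl1,
      ENNReal.toReal_ofReal (by positivity)]
  · rw [integral_eq_lintegral_of_nonneg_ae (ae_of_all _ fun a => sq_nonneg _)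
      (hY.pow_const 2).aestronglyMeasurable, hl2, ENNReal.toReal_ofReal (by positivity)]

/-! ### The exponential law and its truncated mean -/

section Exponential

variable {r : ℝ}

theorem expMeasure_real_Iic (hr : 0 < r) {t : ℝ} (ht : 0 ≤ t) :
    (expMeasure r).real (Set.Iic t) = 1 - Real.exp (-(r * t)) := by
  have := isProbabilityMeasure_expMeasure hr
  rw [← cdf_eq_real, cdf_expMeasure_eq hr, if_pos ht]

theorem ae_pos_expMeasure (hr : 0 < r) : ∀ᵐ x ∂expMeasure r, 0 < x := by
  have := isProbabilityMeasure_expMeasure hr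
  have h := expMeasure_real_Iic hr le_rfl
  rw [mul_zero, neg_zero, Real.exp_zero, sub_self, measureReal_eq_zero_iff] at h
  rw [ae_iff]
  convert! h using 2
  ext x
  simp

theorem moments_expMeasure (hr : 0 < r) :
    MemLp (fun x : ℝ => x) 2 (expMeasure r) ∧ ∫ x, x ∂expMeasure r = 1 / r := by
  have := isProbabilityMeasure_expMeasure hr
  have h := moments_of_cdf_eq_pow (ν := expMeasure r) hr (k := 1) (Y := fun x => x) measurable_id
    ((ae_pos_expMeasure hr).mono fun x hx => hx.le) fun t ht => by
      rw [pow_one]; exact expMeasure_real_Iic hr ht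
  refine ⟨h.1, ?_⟩
  rw [h.2.1]
  simp [genHarmonic]

/-- For an exponential variable `X` with rate `r`, `E[min X y] = P(X ≤ y) / r`. -/
theorem integral_min_expMeasure (hr : 0 < r) {y : ℝ} (hy : 0 ≤ y) :
    ∫ x, min x y ∂expMeasure r = (1 / r) * (expMeasure r).real (Set.Iic y) := by
  have := isProbabilityMeasure_expMeasure hr
  have hint : Integrable (fun x => min x y) (expMeasure r) :=
    ((moments_expMeasure hr).1.integrable (by norm_num)).inf (integrable_const y)
  rw [hint.integral_eq_integral_meas_lt
    ((ae_pos_expMeasure hr).mono fun x hx => le_min hx.le hy), expMeasure_real_Iic hr hy]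
  -- The tail of `min X y` is the exponential tail cut off at `y`, and `∫₀^y exp (-r t) dt = (1 -
  -- exp (-r y)) / r`.
  have h1 : ∀ t ∈ Set.Ioi (0 : ℝ), (expMeasure r).real {x | t < min x y} =
      (Set.Iio y).indicator (fun t => Real.exp (-(r * t))) t := by
    intro t ht
    by_cases hty : t < y
    · rw [Set.indicator_of_mem (by exact hty)]
      have : {x : ℝ | t < min x y} = (Set.Iic t)ᶜ := by ext x; simp [hty]
      rw [this, probReal_compl_eq_one_sub measurableSet_Iic, expMeasure_real_Iic hr (le_of_lt ht)]
      ring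
    · rw [Set.indicator_of_notMem (by exact hty)]
      have : {x : ℝ | t < min x y} = ∅ := by ext x; simp [hty]
      rw [this, measureReal_empty]
  rw [setIntegral_congr_fun measurableSet_Ioi h1, setIntegral_indicator measurableSet_Iio,
    Set.Ioi_inter_Iio, ← integral_Ioc_eq_integral_Ioo, ← intervalIntegral.integral_of_le hy]
  have h2 : ∀ t ∈ Set.uIcc 0 y, HasDerivAt (fun a => (1 / r) * -Real.exp (-(r * a)))
      (Real.exp (-(r * t))) t := by
    intro t _
    refine (hasDerivAt_neg_exp_mul_exp.const_mul (1 / r)).congr_deriv ?_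
    field_simp
  rw [intervalIntegral.integral_eq_sub_of_hasDerivAt h2
    (Continuous.intervalIntegrable (by fun_prop) _ _)]
  simp
  ring

end Exponential

/-! ### One cycle: service interval and delivery probability -/

section ServiceInterval

variable {n : ℕ}

/-- The largest of the first `k` coordinates. -/
noncomputable def prioMax (k : ℕ) (v : Fin n → ℝ) : ℝ := ⨆ i : {i : Fin n // (i : ℕ) < k}, v i.1

theorem measurable_prioMax (k : ℕ) : Measurable (prioMax (n := n) k) :=
  Measurable.iSup fun i => measurable_pi_apply i.1

theorem le_prioMax {k : ℕ} (v : Fin n → ℝ) {i : Fin n} (hi : (i : ℕ) < k) : v i ≤ prioMax k v :=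
  le_ciSup (f := fun i : {i : Fin n // (i : ℕ) < k} => v i.1) (Set.finite_range _).bddAbove ⟨i, hi⟩

variable {k : ℕ} {r : ℝ}

theorem prioMax_le_iff (hk : 1 ≤ k) (hkn : k ≤ n) (v : Fin n → ℝ) (t : ℝ) :
    prioMax k v ≤ t ↔ ∀ i : Fin n, (i : ℕ) < k → v i ≤ t := by
  have : Nonempty {i : Fin n // (i : ℕ) < k} := ⟨⟨⟨0, by omega⟩, hk⟩⟩
  exact ⟨fun h i hi => (le_prioMax v hi).trans h, fun h => ciSup_le fun i => h i.1 i.2⟩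

theorem ae_pos_pi_expMeasure (hr : 0 < r) :
    ∀ᵐ v ∂Measure.pi (fun _ : Fin n => expMeasure r), ∀ i, 0 < v i := by
  have := isProbabilityMeasure_expMeasure hr
  exact ae_all_iff.2 fun i =>
    (measurePreserving_eval (fun _ : Fin n => expMeasure r) i).quasiMeasurePreserving.ae
      (ae_pos_expMeasure hr)

theorem ae_pos_prioMax (hr : 0 < r) (hk : 1 ≤ k) (hkn : k ≤ n) :
    ∀ᵐ v ∂Measure.pi (fun _ : Fin n => expMeasure r), 0 < prioMax k v :=
  (ae_pos_pi_expMeasure hr).mono fun v hv =>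
    (hv ⟨0, by omega⟩).trans_le (le_prioMax v (i := ⟨0, by omega⟩) hk)

theorem cdf_prioMax (hr : 0 < r) (hk : 1 ≤ k) (hkn : k ≤ n) {t : ℝ} (ht : 0 ≤ t) :
    (Measure.pi (fun _ : Fin n => expMeasure r)).real {v | prioMax k v ≤ t} =
      (1 - Real.exp (-(r * t))) ^ k := by
  have := isProbabilityMeasure_expMeasure hr
  have h1 : {v : Fin n → ℝ | prioMax k v ≤ t} =
      Set.univ.pi fun i : Fin n => if (i : ℕ) < k then Set.Iic t else Set.univ := by
    ext v
    rw [Set.mem_ofPred_eq, prioMax_le_iff hk hkn, Set.mem_univ_pi]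
    refine forall_congr' fun i => ?_
    split_ifs with h <;> simp [h]
  rw [h1, measureReal_def, Measure.pi_pi, ENNReal.toReal_prod]
  have h2 : ∀ i : Fin n, ((expMeasure r) (if (i : ℕ) < k then Set.Iic t else Set.univ)).toReal =
      if (i : ℕ) < k then 1 - Real.exp (-(r * t)) else 1 := by
    intro i
    split_ifs
    · exact expMeasure_real_Iic hr ht
    · simp
  simp_rw [h2]
  rw [Finset.prod_ite, Finset.prod_const_one, mul_one, Finset.prod_const]
  congr 1
  rw [Fin.card_filter_val_lt, min_eq_right hkn]

theorem moments_prioMax (hr : 0 < r) (hk : 1 ≤ k) (hkn : k ≤ n) :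
    MemLp (prioMax k) 2 (Measure.pi (fun _ : Fin n => expMeasure r)) ∧
      ∫ v, prioMax k v ∂Measure.pi (fun _ : Fin n => expMeasure r) = genHarmonic 1 k / r ∧
      ∫ v, prioMax k v ^ 2 ∂Measure.pi (fun _ : Fin n => expMeasure r) =
        (genHarmonic 1 k ^ 2 + genHarmonic 2 k) / r ^ 2 := by
  have := isProbabilityMeasure_expMeasure hr
  exact moments_of_cdf_eq_pow hr (measurable_prioMax k)
    ((ae_pos_prioMax hr hk hkn).mono fun v hv => hv.le) fun t ht => cdf_prioMax hr hk hkn ht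

theorem hasLaw_eval_pi_expMeasure (hr : 0 < r) (i : Fin n) :
    HasLaw (fun v : Fin n → ℝ => v i) (expMeasure r)
      (Measure.pi (fun _ : Fin n => expMeasure r)) := by
  have := isProbabilityMeasure_expMeasure hr
  exact (measurePreserving_eval (fun _ : Fin n => expMeasure r) i).hasLaw

theorem indepFun_prioMax_eval (hr : 0 < r) {i : Fin n} (hi : k ≤ (i : ℕ)) :
    IndepFun (prioMax k) (fun v : Fin n → ℝ => v i)
      (Measure.pi (fun _ : Fin n => expMeasure r)) := by
  have := isProbabilityMeasure_expMeasure hr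
  have h : iIndepFun (fun (i : Fin n) (v : Fin n → ℝ) => v i)
      (Measure.pi (fun _ : Fin n => expMeasure r)) :=
    iIndepFun_pi (X := fun _ x => x) fun i => aemeasurable_id
  set S : Finset (Fin n) := Finset.univ.filter fun j => (j : ℕ) < k with hS
  have hdisj : Disjoint S {i} := by
    rw [Finset.disjoint_singleton_right]
    simp [hS, hi]
  have h2 := h.indepFun_finset S {i} hdisj fun j => measurable_pi_apply j
  have hφ : Measurable fun w : S → ℝ =>
      ⨆ j : {j : Fin n // (j : ℕ) < k}, w ⟨j.1, by simp [hS, j.2]⟩ :=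
    Measurable.iSup fun j => measurable_pi_apply _
  have hψ : Measurable fun w : ({i} : Finset (Fin n)) → ℝ => w ⟨i, by simp⟩ :=
    measurable_pi_apply _
  exact h2.comp hφ hψ

/-- The mean time for which the transmission of an update to node `i` lasts is the probability of
its delivery divided by the rate. -/
theorem integral_min_eval_prioMax (hr : 0 < r) (hk : 1 ≤ k) (hkn : k ≤ n) (i : Fin n) :
    ∫ v, min (v i) (prioMax k v) ∂Measure.pi (fun _ : Fin n => expMeasure r) =
      (1 / r) * (1 - ∫ v, (if v i ≤ prioMax k v then (0 : ℝ) else 1)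
        ∂Measure.pi (fun _ : Fin n => expMeasure r)) := by
  have := isProbabilityMeasure_expMeasure hr
  set ν := Measure.pi (fun _ : Fin n => expMeasure r) with hν
  have hm := measurable_prioMax (n := n) k
  by_cases hi : (i : ℕ) < k
  · have h1 : ∀ v : Fin n → ℝ, v i ≤ prioMax k v := fun v => le_prioMax v hi
    simp only [h1, inf_of_le_left, if_true, integral_zero, sub_zero, mul_one]
    rw [(hasLaw_eval_pi_expMeasure hr i).integral_eq, (moments_expMeasure hr).2]
  · have hmY : Measurable (fun p : ℝ × ℝ => if p.2 ≤ p.1 then (0 : ℝ) else 1) :=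
      Measurable.ite (measurableSet_le measurable_snd measurable_fst) measurable_const
        measurable_const
    -- For a non-priority node the claim is that `φ` has mean zero; by independence and Fubini it
    -- has mean zero already for each fixed service interval `y ≥ 0`.
    set φ : ℝ × ℝ → ℝ := fun p => min p.2 p.1 - (1 / r) * (1 - if p.2 ≤ p.1 then (0 : ℝ) else 1)
      with hφ
    have hφm : Measurable φ := (measurable_snd.min measurable_fst).sub
      ((hmY.const_sub 1).const_mul _)
    set Q := ν.map (prioMax k) with hQ
    have hQp : IsProbabilityMeasure Q := Measure.isProbabilityMeasure_map hm.aemeasurable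
    have hlawY : HasLaw (prioMax k) Q ν := ⟨hm.aemeasurable, rfl⟩
    have hlaw : HasLaw (fun v : Fin n → ℝ => (prioMax k v, v i)) (Q.prod (expMeasure r)) ν :=
      (indepFun_iff_hasLaw_prodMk_prod hlawY (hasLaw_eval_pi_expMeasure hr i)).1
        (indepFun_prioMax_eval hr (not_lt.1 hi))
    have hint1 : Integrable (fun v : Fin n → ℝ => min (v i) (prioMax k v)) ν :=
      ((memLp_comp_of_hasLaw (hasLaw_eval_pi_expMeasure hr i)
        (moments_expMeasure hr).1).integrable (by norm_num)).inf
        ((moments_prioMax hr hk hkn).1.integrable (by norm_num))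
    have hint2 : Integrable (fun v : Fin n → ℝ => if v i ≤ prioMax k v then (0 : ℝ) else 1) ν :=
      Integrable.of_bound (hmY.comp (hm.prodMk (measurable_pi_apply i))).aestronglyMeasurable 1
        (ae_of_all _ fun v => by split_ifs <;> simp)
    have hint3 : Integrable (fun v : Fin n → ℝ =>
        1 / r * (1 - if v i ≤ prioMax k v then (0 : ℝ) else 1)) ν := ((integrable_const (1 : ℝ)).sub hint2).const_mul (1 / r)
    have hφint : Integrable φ (Q.prod (expMeasure r)) := by
      rw [← hlaw.map_eq]
      exact (integrable_map_measure hφm.aestronglyMeasurable hlaw.aemeasurable).2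
        (hint1.sub hint3)
    have hzero : ∫ v, φ (prioMax k v, v i) ∂ν = 0 := by
      have h1 := hlaw.integral_comp (f := φ) hφm.aestronglyMeasurable
      have h2 : ∫ v, φ (prioMax k v, v i) ∂ν = ∫ p, φ p ∂(Q.prod (expMeasure r)) := h1
      rw [h2, integral_prod φ hφint]
      refine integral_eq_zero_of_ae ?_
      have hpos : ∀ᵐ y ∂Q, 0 ≤ y := by
        rw [hQ, ae_map_iff hm.aemeasurable measurableSet_Ici]
        exact (ae_pos_prioMax hr hk hkn).mono fun v hv => hv.le
      filter_upwards [hpos] with y hy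
      have h3 : ∀ x : ℝ, (1 - if x ≤ y then (0 : ℝ) else 1) =
          (Set.Iic y).indicator (fun _ => (1 : ℝ)) x := by
        intro x
        by_cases h : x ≤ y <;> simp [h]
      simp only [hφ, h3, Pi.zero_apply]
      rw [integral_sub, integral_const_mul, integral_min_expMeasure hr hy,
        integral_indicator_const _ measurableSet_Iic]
      · simp
      · exact ((moments_expMeasure hr).1.integrable (by norm_num)).inf (integrable_const y)
      · exact ((integrable_const (1 : ℝ)).indicator measurableSet_Iic).const_mul _
    simp only [hφ] at hzero
    rw [integral_sub hint1 hint3, integral_const_mul, integral_sub (integrable_const _) hint2]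
      at hzero
    simpa using sub_eq_zero.1 hzero

/-- The mean of a positive variable is positive, and here it equals the delivery probability divided
by `r`; that probability need not be computed. -/
theorem integral_missed_lt_one (hr : 0 < r) (hk : 1 ≤ k) (hkn : k ≤ n) (i : Fin n) :
    ∫ v, (if v i ≤ prioMax k v then (0 : ℝ) else 1)
      ∂Measure.pi (fun _ : Fin n => expMeasure r) < 1 := by
  have := isProbabilityMeasure_expMeasure hr
  have hint1 : Integrable (fun v : Fin n → ℝ => min (v i) (prioMax k v))
      (Measure.pi (fun _ : Fin n => expMeasure r)) :=
    ((memLp_comp_of_hasLaw (hasLaw_eval_pi_expMeasure hr i)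
      (moments_expMeasure hr).1).integrable (by norm_num)).inf
      ((moments_prioMax hr hk hkn).1.integrable (by norm_num))
  have hae : ∀ᵐ v ∂Measure.pi (fun _ : Fin n => expMeasure r), 0 < min (v i) (prioMax k v) := by
    filter_upwards [ae_pos_pi_expMeasure hr, ae_pos_prioMax hr hk hkn] with v h1 h2
    exact lt_min (h1 i) h2
  have hpos : 0 < ∫ v, min (v i) (prioMax k v) ∂Measure.pi (fun _ : Fin n => expMeasure r) := by
    have h0 := hae.mono fun v hv => hv.le
    refine lt_of_le_of_ne (integral_nonneg_of_ae h0) fun h => ?_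
    have h1 := (integral_eq_zero_iff_of_nonneg_ae h0 hint1).1 h.symm
    obtain ⟨v, hv1, hv2⟩ := (hae.and h1).exists
    exact hv1.ne' hv2
  rw [integral_min_eval_prioMax hr hk hkn] at hpos
  have := pos_of_mul_pos_right hpos (by positivity)
  linarith

end ServiceInterval

/-! ### Independence of the cycles and the limit -/

/-- The columns of an independent array with finitely many rows are independent. -/
theorem iIndepFun_columns [IsProbabilityMeasure P] {n : ℕ} {X : Fin n → ℕ → Ω → ℝ}
    (hX : ∀ i j, Measurable (X i j)) (hindep : iIndepFun (fun p : Fin n × ℕ => X p.1 p.2) P) :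
    iIndepFun (fun j ω i => X i j ω) P := by
  have _ : ∀ j i, IsProbabilityMeasure (P.map (X i j)) := fun j i =>
    Measure.isProbabilityMeasure_map (hX i j).aemeasurable
  have h1 : iIndepFun (fun p : (_ : ℕ) × Fin n => X p.2 p.1) P :=
    hindep.precomp (g := fun p : (_ : ℕ) × Fin n => (p.2, p.1)) (by
      rintro ⟨a, b⟩ ⟨c, d⟩ h
      simp only [Prod.mk.injEq] at h
      simp [h.1, h.2])
  have h2 := h1.map_fun_eq_infinitePi_map fun p : (_ : ℕ) × Fin n => hX p.2 p.1
  have hcol : ∀ j, iIndepFun (fun i => X i j) P := fun j =>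
    hindep.precomp (g := fun i : Fin n => (i, j)) fun a b h => (Prod.mk.injEq _ _ _ _ ▸ h).1
  rw [iIndepFun_iff_map_fun_eq_infinitePi_map fun j => measurable_pi_lambda _ fun i => hX i j]
  -- The family of columns is the curried array, and currying turns the product law into a product
  -- of products.
  have h3 : (fun ω j i => X i j ω) =
      (MeasurableEquiv.piCurry fun (_ : ℕ) (_ : Fin n) => ℝ) ∘
        (fun ω (p : (_ : ℕ) × Fin n) => X p.2 p.1 ω) := by
    ext
    simp [Sigma.curry]
  rw [h3, ← Measure.map_map (MeasurableEquiv.measurable _)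
    (measurable_pi_lambda _ fun p : (_ : ℕ) × Fin n => hX p.2 p.1), h2,
    Measure.infinitePi_map_piCurry (fun (j : ℕ) (i : Fin n) => P.map (X i j))]
  congr 1
  ext1 j
  rw [(hcol j).map_fun_eq_infinitePi_map fun i => hX i j]

theorem ae_hasTimeAverage_age_of_measurable [IsProbabilityMeasure P] {n k : ℕ} (hk : 1 ≤ k)
    (hkn : k ≤ n) {r : ℝ} (hr : 0 < r) {X : Fin n → ℕ → Ω → ℝ} (hX : ∀ i j, Measurable (X i j))
    (hlaw : ∀ i j, HasLaw (X i j) (expMeasure r) P)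
    (hindep : iIndepFun (fun p : Fin n × ℕ => X p.1 p.2) P)
    {u₀ : Fin n → Ω → ℝ} (hu₀ : ∀ i ω, u₀ i ω ≤ 0) (i : Fin n) :
    ∀ᵐ ω ∂P, HasTimeAverage (fun t => age k X u₀ i t ω)
      (1 / r + genHarmonic 1 k / (2 * r) + genHarmonic 2 k / (2 * r * genHarmonic 1 k)) := by
  have := isProbabilityMeasure_expMeasure hr
  set ν := Measure.pi (fun _ : Fin n => expMeasure r) with hν
  set ξ : ℕ → Ω → (Fin n → ℝ) := fun j ω i => X i j ω with hξ
  have hξm : ∀ j, Measurable (ξ j) := fun j => measurable_pi_lambda _ fun i => hX i j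
  have hξlaw : ∀ j, HasLaw (ξ j) ν P := fun j =>
    iIndepFun.hasLaw_pi (fun i => hlaw i j) (hindep.precomp (g := fun i : Fin n => (i, j))
      fun a b h => (Prod.mk.injEq _ _ _ _ ▸ h).1)
  have hξind : iIndepFun ξ P := iIndepFun_columns hX hindep
  obtain ⟨hY2, hEY, hEY2⟩ := moments_prioMax (n := n) hr hk hkn
  have hYm := measurable_prioMax (n := n) k
  have hH := genHarmonic_pos 1 hk
  have hHne := hH.ne'
  have hq := integral_missed_lt_one hr hk hkn i
  have hEM := integral_min_eval_prioMax hr hk hkn i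
  have hMm : Measurable (fun v : Fin n → ℝ => min (v i) (prioMax k v)) :=
    (measurable_pi_apply i).min hYm
  have hM2 : MemLp (fun v : Fin n → ℝ => min (v i) (prioMax k v)) 2 ν := by
    refine hY2.mono' hMm.aestronglyMeasurable ?_
    filter_upwards [ae_pos_pi_expMeasure hr, ae_pos_prioMax hr hk hkn] with v h1 h2
    rw [Real.norm_of_nonneg (le_min (h1 i).le h2.le)]
    exact min_le_right _ _
  have hhm : Measurable (fun v : Fin n → ℝ => if v i ≤ prioMax k v then (0 : ℝ) else 1) :=
    Measurable.ite (measurableSet_le (measurable_pi_apply i) hYm) measurable_const measurable_const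
  have hhint : Integrable (fun v : Fin n → ℝ => if v i ≤ prioMax k v then (0 : ℝ) else 1) ν :=
    Integrable.of_bound hhm.aestronglyMeasurable 1
      (ae_of_all _ fun v => by split_ifs <;> simp)
  have hpos : ∀ᵐ ω ∂P, ∀ j i, 0 < ξ j ω i := ae_all_iff.2 fun j => by
    have h := ae_pos_pi_expMeasure (n := n) hr
    change ∀ᵐ v ∂ν, _ at h
    rw [← (hξlaw j).map_eq] at h
    exact ae_of_ae_map (hξlaw j).aemeasurable h
  filter_upwards [hpos,
    ae_tendsto_average_comp hξm hξlaw hξind hYm (hY2.integrable (by norm_num)),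
    ae_tendsto_average_comp hξm hξlaw hξind (hYm.pow_const 2) hY2.integrable_sq,
    ae_tendsto_average_comp hξm hξlaw hξind hhm hhint,
    ae_tendsto_average_mul_affineRec hξm hξlaw hξind hYm hhm hY2
      (fun v => by split_ifs <;> simp) hq hMm hM2] with ω h1 h2 h3 h4 h5
  set y : ℕ → ℝ := fun j => prioMax k (ξ j ω) with hy
  set x : ℕ → ℝ := fun j => ξ j ω i with hx
  -- Without any delivery the frequency of misses would be `1`, but it tends to `q < 1`.
  have hdel : ∃ j, x j ≤ y j := by
    by_contra hno
    push Not at hno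
    have h6 : Tendsto (fun N : ℕ => (∑ j ∈ Finset.range N,
        if ξ j ω i ≤ prioMax k (ξ j ω) then (0 : ℝ) else 1) / N) atTop (𝓝 1) := by
      refine tendsto_const_nhds.congr' ?_
      filter_upwards [eventually_gt_atTop 0] with N hN
      have h7 : (N : ℝ) ≠ 0 := by positivity
      rw [Finset.sum_congr rfl fun j _ => if_neg (not_le.2 (hno j))]
      simp [h7]
    exact hq.ne (tendsto_nhds_unique h4 h6)
  rw [hEY] at h2
  rw [hEY2] at h3
  rw [hEM, hEY] at h5
  have hx0 : ∀ j, 0 ≤ x j := fun j => (h1 j i).le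
  have hy0 : ∀ j, 0 ≤ y j := fun j =>
    (h1 j ⟨0, by omega⟩).le.trans (le_prioMax (ξ j ω) (i := ⟨0, by omega⟩) hk)
  have hmain := hasTimeAverage_age hy0 hx0 (hu₀ i ω) hdel (div_pos hH hr) h2 h3 h5
  have hval : 1 / r + genHarmonic 1 k / (2 * r) + genHarmonic 2 k / (2 * r * genHarmonic 1 k) =
      ((genHarmonic 1 k ^ 2 + genHarmonic 2 k) / r ^ 2 / 2 + 1 / r * genHarmonic 1 k / r) /
        (genHarmonic 1 k / r) := by
    field_simp
    ring
  -- Here the delivery probability `1 - q`, and with it the dependence on the node, drops out.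
  have hcancel : ∀ a b c : ℝ, c ≠ 0 → a * c * (b / c) = a * b := fun a b c hc => by field_simp
  rw [hcancel _ _ _ (sub_pos.2 hq).ne', ← mul_div_assoc] at hmain
  rw [hval]
  exact hmain

/-- `HasLaw` gives only a.e. measurability. There are countably many delays, so replacing each by a
measurable version leaves almost every whole age path unchanged. -/
theorem ae_hasTimeAverage_age [IsProbabilityMeasure P] {n k : ℕ} (hk : 1 ≤ k)
    (hkn : k ≤ n) {r : ℝ} (hr : 0 < r) {X : Fin n → ℕ → Ω → ℝ}
    (hlaw : ∀ i j, HasLaw (X i j) (expMeasure r) P)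
    (hindep : iIndepFun (fun p : Fin n × ℕ => X p.1 p.2) P)
    {u₀ : Fin n → Ω → ℝ} (hu₀ : ∀ i ω, u₀ i ω ≤ 0) (i : Fin n) :
    ∀ᵐ ω ∂P, HasTimeAverage (fun t => age k X u₀ i t ω)
      (1 / r + genHarmonic 1 k / (2 * r) + genHarmonic 2 k / (2 * r * genHarmonic 1 k)) := by
  set X' : Fin n → ℕ → Ω → ℝ := fun i j => (hlaw i j).aemeasurable.mk (X i j) with hX'
  have heq : ∀ i j, X i j =ᵐ[P] X' i j := fun i j => (hlaw i j).aemeasurable.ae_eq_mk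
  have hall : ∀ᵐ ω ∂P, ∀ i j, X i j ω = X' i j ω :=
    ae_all_iff.2 fun i => ae_all_iff.2 fun j => heq i j
  have hmain := ae_hasTimeAverage_age_of_measurable hk hkn hr
    (fun i j => (hlaw i j).aemeasurable.measurable_mk) (fun i j => (hlaw i j).congr (heq i j).symm)
    (hindep.congr fun p => heq p.1 p.2) hu₀ i
  filter_upwards [hall, hmain] with ω h1 h2
  have hY : ∀ j, serviceInterval k X j ω = serviceInterval k X' j ω := fun j => by
    simp only [serviceInterval, h1]
  have hage : ∀ t, age k X u₀ i t ω = age k X' u₀ i t ω := fun t => by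
    simp only [age, lastTimestamp, Delivered, timestamp, hY, h1]
  simpa only [hage] using h2

end MulticastAge

theorem theorem3 {Ω : Type*} [MeasurableSpace Ω] (P : MeasureTheory.Measure Ω)
    [MeasureTheory.IsProbabilityMeasure P] (n k : ℕ) (hk : 1 ≤ k) (hkn : k ≤ n)
    (rate : ℝ) (hrate : 0 < rate)
    (X : Fin n → ℕ → Ω → ℝ)
    (hlaw : ∀ i j, ProbabilityTheory.HasLaw (X i j) (ProbabilityTheory.expMeasure rate) P)
    (hindep : ProbabilityTheory.iIndepFun (fun p : Fin n × ℕ => X p.1 p.2) P)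
    (u₀ : Fin n → Ω → ℝ) (hu₀ : ∀ i ω, u₀ i ω ≤ 0) :
    (∀ i : Fin n, (i : ℕ) < k → ∀ᵐ ω ∂P,
      MulticastAge.HasTimeAverage (fun t => MulticastAge.age k X u₀ i t ω)
        (1 / rate + MulticastAge.genHarmonic 1 k / (2 * rate) +
          MulticastAge.genHarmonic 2 k / (2 * rate * MulticastAge.genHarmonic 1 k))) ∧
    (∀ i : Fin n, k ≤ (i : ℕ) → ∀ᵐ ω ∂P,
      MulticastAge.HasTimeAverage (fun t => MulticastAge.age k X u₀ i t ω)
        (1 / rate + MulticastAge.genHarmonic 1 k / (2 * rate) +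
          MulticastAge.genHarmonic 2 k / (2 * rate * MulticastAge.genHarmonic 1 k))) :=
  ⟨fun i _ => MulticastAge.ae_hasTimeAverage_age hk hkn hrate hlaw hindep hu₀ i,
    fun i _ => MulticastAge.ae_hasTimeAverage_age hk hkn hrate hlaw hindep hu₀ i⟩
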